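/- A local field is a field $K$ that is complete with respect to a normalized discrete valuation $v_K\colon K^*\twoheadrightarrow\mathbb{Z}$ (the residue field is arbitrary). Let $L/K$ be a finite Galois extension of local fields with Galois group $G$ and normalized valuations $v_K$, $v_L$. Let $e_{L/K}$ be the ramification index, given by $v_L(K^*)=e_{L/K}\mathbb{Z}$; let $d_{L/K}$ be the valuation of the different of $L/K$, that is, the exponent of the maximal ideal of the valuation ring of $L$ in the different; and let $p$ be the characteristic of the residue field of $K$. An element $x\in L$ is called normal over $K$ if its conjugates under $G$ form a basis of $L$ as a $K$-vector space. Let $\mathrm{VC}(L/K)$ be the statement: every $x\in L^*$ with $v_L(x)\equiv -d_{L/K}-1 \pmod{e_{L/K}}$ is normal over $K$. Then $\mathrm{VC}(L/K)$ holds if and only if the following two conditions hold: (1) $L/K$ is totally ramified (that is, $e_{L/K}=[L:K]$) and $[L:K]$ is a power of $p$ (if $p=0$, this means $[L:K]=1$); (2) every non-zero $K[G]$-submodule of $L$ contains an element of valuation $0$. -/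

import Mathlib

open scoped WithZero

namespace ValuationCriterion

section LocalField

variable (K : Type*) [Field K] [Valued K ℤᵐ⁰]

/-- A local field: a field that is complete with respect to a (normalized) discrete valuation
`K ↠ ℤ ∪ {∞}`, here written multiplicatively. The residue field is arbitrary. -/
class IsLocalField : Prop extends CompleteSpace K where
  surjective_v : Function.Surjective (Valued.v : Valuation K ℤᵐ⁰)

/-- The valuation ring. -/
abbrev ringOfIntegers : ValuationSubring K := (Valued.v : Valuation K ℤᵐ⁰).valuationSubring

/-- The residue characteristic (it is `0` if the residue field has characteristic zero). -/
noncomputable def residueChar : ℕ := ringChar (IsLocalRing.ResidueField (ringOfIntegers K))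

variable {K}

instance [IsLocalField K] : IsDiscreteValuationRing (ringOfIntegers K) := by
  let v : Valuation K ℤᵐ⁰ := Valued.v
  let e : (ℤᵐ⁰)ˣ := WithZero.expEquiv 1
  have hmem : e ∈ MonoidWithZeroHom.valueGroup (.ofClass v) :=
    MonoidWithZeroHom.mem_valueGroup _ (by
      obtain ⟨x, hx⟩ := IsLocalField.surjective_v (K := K) e
      exact ⟨x, hx⟩)
  have hne : e ≠ 1 := by
    intro h
    have := congrArg WithZero.logEquiv h
    simp [e] at this
  have : IsCyclic (ℤᵐ⁰)ˣ :=
    isCyclic_of_surjective (WithZero.unitsWithZeroEquiv (α := Multiplicative ℤ)).symm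
      (MulEquiv.surjective _)
  have : Nontrivial (MonoidWithZeroHom.valueGroup (.ofClass v)) :=
    ⟨⟨e, hmem⟩, 1, fun h => hne (congrArg Subtype.val h)⟩
  exact Valuation.valuationSubring_isDiscreteValuationRing v

/-- The additive normalized valuation of a non-zero element
(the value at `0` is irrelevant and never used). -/
def ord (x : K) : ℤ := -WithZero.log (Valued.v x)

end LocalField

section Extension

variable (K L : Type*) [Field K] [Field L] [Valued K ℤᵐ⁰] [Valued L ℤᵐ⁰] [Algebra K L]

/-- The subgroup `v_L(K*)` of `ℤ`. -/
def valueSubgroup : AddSubgroup ℤ where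
  carrier := {m | ∃ x : K, x ≠ 0 ∧ ord (algebraMap K L x) = m}
  zero_mem' := ⟨1, one_ne_zero, by simp [ord]⟩
  add_mem' := by
    rintro _ _ ⟨x, hx, rfl⟩ ⟨y, hy, rfl⟩
    refine ⟨x * y, mul_ne_zero hx hy, ?_⟩
    simp only [ord, map_mul]
    rw [WithZero.log_mul (by simpa using hx) (by simpa using hy)]
    ring
  neg_mem' := by
    rintro _ ⟨x, hx, rfl⟩
    refine ⟨x⁻¹, inv_ne_zero hx, ?_⟩
    simp [ord, WithZero.log_inv]

/-- The ramification index `e`, given by `v_L(K*) = eℤ`. -/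
noncomputable def ramificationIndex : ℕ := (valueSubgroup K L).index

/-- The extension is totally ramified: `e = [L : K]`. -/
def IsTotallyRamified : Prop := ramificationIndex K L = Module.finrank K L

instance [(Valued.v : Valuation K ℤᵐ⁰).HasExtension (Valued.v : Valuation L ℤᵐ⁰)] :
    Module.IsTorsionFree (ringOfIntegers K) (ringOfIntegers L) :=
  inferInstanceAs (Module.IsTorsionFree (Valued.v : Valuation K ℤᵐ⁰).integer
    (Valued.v : Valuation L ℤᵐ⁰).integer)

/-- The valuation of the different: the exponent of the maximal ideal of `O_L` in the
different ideal of `O_L` over `O_K`. -/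
noncomputable def differentExponent [IsLocalField L]
    [(Valued.v : Valuation K ℤᵐ⁰).HasExtension (Valued.v : Valuation L ℤᵐ⁰)] : ℕ :=
  multiplicity (IsLocalRing.maximalIdeal (ringOfIntegers L))
    (differentIdeal (ringOfIntegers K) (ringOfIntegers L))

variable {L} in
/-- `x` is a normal basis generator: its conjugates form a `K`-basis of `L`. -/
def IsNormalElement (x : L) : Prop :=
  ∃ b : Module.Basis Gal(L/K) K L, ∀ σ : Gal(L/K), b σ = σ x

/-- The valuation criterion `VC(L/K)`. -/
def VC [IsLocalField L]
    [(Valued.v : Valuation K ℤᵐ⁰).HasExtension (Valued.v : Valuation L ℤᵐ⁰)] : Prop :=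
  ∀ x : L, x ≠ 0 →
    ord x ≡ -(differentExponent K L : ℤ) - 1 [ZMOD (ramificationIndex K L : ℤ)] →
    IsNormalElement K x

variable {K L} in
/-- A `K`-subspace of `L` that is a `K[G]`-submodule, i.e. stable under `G = Gal(L/K)`. -/
def IsGaloisStable (V : Submodule K L) : Prop :=
  ∀ σ : Gal(L/K), ∀ x ∈ V, σ x ∈ V

end Extension

end ValuationCriterion

/-! The trace form links both sides. Maximality of `d` among the exponents with integral trace on
`P_L^(-d)` shows that, when the residue extension is trivial, every element of valuation `-d-1` has
non-integral, hence non-zero, trace (`one_lt_v_trace`). Otherwise some such element has trace zero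
and is not normal, so VC forces total ramification.

In the totally ramified case the dimension of a subspace is bounded by its number of valuation
classes mod `e`. Counting classes in `V` and its orthogonal gives `exists_trace_mul_eq_zero`: if `V`
has no element of valuation 0, some `x` of valuation `-d-1` is orthogonal to it. Under VC this `x`
is normal, so a stable `V` must vanish, which is (2).

Applied instead to the image of a non-zero element of `K[G]`, the same lemma yields an element of
valuation 0 in that image; the operator `N_H(1-g)` then shows that `p` divides the index of every
proper subgroup `H`, and a Sylow subgroup gives the `p`-power degree. Conversely, if `x` is not
normal, the orthogonal of its conjugates is a non-zero stable subspace, and an element of valuation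
0 in it contradicts non-vanishing of the trace. -/

namespace ValuationCriterion

/-! ### Values and topology of a local field. Since `ord` is minus the logarithm, value `exp i`
means valuation `-i`. -/

section Valued

variable {K : Type*} [Field K] [Valued K ℤᵐ⁰]

local notation "v" => (Valued.v : Valuation K ℤᵐ⁰)

theorem v_eq_exp_iff {x : K} (hx : x ≠ 0) {i : ℤ} : v x = WithZero.exp i ↔ ord x = -i := by
  have h : v x ≠ 0 := by simpa using hx
  rw [ord, neg_inj]
  exact ⟨fun h => by rw [h, WithZero.log_exp], fun h' => by rw [← h', WithZero.exp_log h]⟩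

theorem exists_v_eq_exp [IsLocalField K] (i : ℤ) : ∃ x : K, x ≠ 0 ∧ v x = WithZero.exp i := by
  obtain ⟨x, hx⟩ := IsLocalField.surjective_v (K := K) (WithZero.exp i)
  refine ⟨x, ?_, hx⟩
  rintro rfl
  rw [map_zero] at hx
  exact WithZero.exp_ne_zero hx.symm

theorem mem_nhds_zero_iff [IsLocalField K] {s : Set K} :
    s ∈ nhds (0 : K) ↔ ∃ i : ℤ, {x | v x ≤ WithZero.exp i} ⊆ s := by
  rw [Valued.mem_nhds_zero]
  constructor
  · rintro ⟨γ, hγ⟩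
    obtain ⟨y, hy⟩ := MonoidWithZeroHom.ValueGroup₀.restrict₀_surjective _ γ.val
    change (v).restrict y = γ.val at hy
    have hy0 : v y ≠ 0 := by
      intro h
      have : (v).restrict y = 0 := by simpa using h
      exact γ.ne_zero (hy.symm.trans this)
    refine ⟨WithZero.log (v y) - 1, fun x hx => hγ ?_⟩
    rw [Set.mem_ofPred_eq] at hx ⊢
    rw [← hy, (v).restrict_lt_iff, ← WithZero.exp_log hy0]
    exact hx.trans_lt (by simp only [WithZero.exp_lt_exp]; omega)
  · rintro ⟨i, hi⟩
    obtain ⟨y, hy0, hy⟩ := exists_v_eq_exp (K := K) i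
    refine ⟨Units.mk0 ((v).restrict y) (by simpa using hy0), fun x hx => hi ?_⟩
    rw [Set.mem_ofPred_eq] at hx ⊢
    rw [Units.val_mk0, (v).restrict_lt_iff] at hx
    rw [← hy]
    exact hx.le

/-- The normalized valuation of a local field has rank one. -/
@[reducible]
noncomputable def rankOne [IsLocalField K] : (Valued.v : Valuation K ℤᵐ⁰).RankOne where
  hom' := (WithZeroMulInt.toNNReal (e := 2) two_ne_zero).comp
    MonoidWithZeroHom.ValueGroup₀.embedding
  strictMono' := (WithZeroMulInt.toNNReal_strictMono one_lt_two).comp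
    MonoidWithZeroHom.ValueGroup₀.embedding_strictMono
  exists_val_nontrivial := by
    obtain ⟨x, -, hx⟩ := exists_v_eq_exp (K := K) 1
    exact ⟨x, by simp [hx]⟩

theorem v_sub_le {x y : K} {i : ℤᵐ⁰} (hx : v x ≤ i) (hy : v y ≤ i) : v (x - y) ≤ i :=
  (Valuation.map_sub _ x y).trans (max_le hx hy)

theorem v_add_le {x y : K} {i : ℤᵐ⁰} (hx : v x ≤ i) (hy : v y ≤ i) : v (x + y) ≤ i :=
  (Valuation.map_add _ x y).trans (max_le hx hy)

theorem v_lt_exp_add_one_iff {x : K} {i : ℤ} :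
    v x < WithZero.exp (i + 1) ↔ v x ≤ WithZero.exp i := by
  rcases eq_or_ne (v x) 0 with h | h
  · simp [h]
  · rw [← WithZero.exp_log h, WithZero.exp_lt_exp, WithZero.exp_le_exp]
    omega

end Valued

/-! ### Extension of valuations and Galois invariance. -/

section Extension

variable (K L : Type*) [Field K] [Field L] [Valued K ℤᵐ⁰] [Valued L ℤᵐ⁰] [IsLocalField K]
  [Algebra K L] [(Valued.v : Valuation K ℤᵐ⁰).HasExtension (Valued.v : Valuation L ℤᵐ⁰)]

local notation "v" => (Valued.v : Valuation K ℤᵐ⁰)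
local notation "w" => (Valued.v : Valuation L ℤᵐ⁰)

variable {K} in
-- `HasExtension` gives only equivalence of valuations, but equal `v`-values have equal `w`-values,
-- so a uniformizer determines everything.
theorem exists_v_algebraMap_eq_pow :
    ∃ e : ℕ, e ≠ 0 ∧ ∀ a : K, w (algebraMap K L a) = v a ^ e := by
  obtain ⟨π, hπ0, hπ⟩ := exists_v_eq_exp (K := K) (-1)
  have h1 : w (algebraMap K L π) < 1 := by
    rw [Valuation.HasExtension.val_map_lt_one_iff v w, hπ, ← WithZero.exp_zero, WithZero.exp_lt_exp]
    omega
  have h0 : w (algebraMap K L π) ≠ 0 := by simpa using hπ0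
  obtain ⟨m, hm⟩ : ∃ m : ℤ, w (algebraMap K L π) = WithZero.exp m :=
    ⟨_, (WithZero.exp_log h0).symm⟩
  have hm0 : m < 0 := by
    rw [hm, ← WithZero.exp_zero, WithZero.exp_lt_exp] at h1
    exact h1
  refine ⟨m.natAbs, by omega, fun a => ?_⟩
  rcases eq_or_ne a 0 with rfl | ha
  · simp [zero_pow (show m.natAbs ≠ 0 by omega)]
  obtain ⟨i, hi⟩ : ∃ i : ℤ, v a = WithZero.exp i :=
    ⟨_, (WithZero.exp_log (by simpa using ha)).symm⟩
  have : v a = v (π ^ (-i)) := by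
    rw [map_zpow₀, hπ, hi, ← WithZero.exp_zsmul]
    simp
  rw [(Valuation.HasExtension.val_map_eq_iff v w _ _).mpr this, map_zpow₀, map_zpow₀, hm, hi,
    ← WithZero.exp_zsmul, ← WithZero.exp_nsmul]
  congr 1
  simp only [smul_eq_mul, nsmul_eq_mul, Int.natCast_natAbs, abs_of_neg hm0]
  ring

theorem ramificationIndex_ne_zero_and_v_algebraMap :
    ramificationIndex K L ≠ 0 ∧
      ∀ a : K, w (algebraMap K L a) = v a ^ ramificationIndex K L := by
  obtain ⟨e, he, h⟩ := exists_v_algebraMap_eq_pow (K := K) L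
  suffices ramificationIndex K L = e by rw [this]; exact ⟨he, h⟩
  have : valueSubgroup K L = AddSubgroup.zmultiples (e : ℤ) := by
    ext m
    rw [Int.mem_zmultiples_iff]
    constructor
    · rintro ⟨x, hx, rfl⟩
      rw [ord, h, WithZero.log_pow]
      simp
    · rintro ⟨k, rfl⟩
      obtain ⟨x, hx0, hx⟩ := exists_v_eq_exp (K := K) (-k)
      refine ⟨x, hx0, ?_⟩
      rw [ord, h, hx, WithZero.log_pow, WithZero.log_exp]
      simp
  rw [ramificationIndex, this, Int.index_zmultiples]
  simp

theorem ramificationIndex_ne_zero : ramificationIndex K L ≠ 0 :=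
  (ramificationIndex_ne_zero_and_v_algebraMap K L).1

variable {K} in
theorem v_algebraMap (a : K) : w (algebraMap K L a) = v a ^ ramificationIndex K L :=
  (ramificationIndex_ne_zero_and_v_algebraMap K L).2 a

theorem continuousSMul [IsLocalField L] : ContinuousSMul K L := by
  have : Continuous (algebraMap K L) := by
    refine continuous_of_continuousAt_zero _ ?_
    intro s hs
    rw [map_zero, mem_nhds_zero_iff] at hs
    obtain ⟨i, hi⟩ := hs
    rw [Filter.mem_map, mem_nhds_zero_iff]
    refine ⟨-i.natAbs, fun x hx => hi ?_⟩
    rw [Set.mem_ofPred_eq] at hx ⊢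
    rw [v_algebraMap]
    refine (pow_le_pow_left₀ zero_le hx _).trans ?_
    rw [← WithZero.exp_nsmul, WithZero.exp_le_exp, nsmul_eq_mul]
    have := Nat.one_le_iff_ne_zero.mpr (ramificationIndex_ne_zero K L)
    have : (1 : ℤ) ≤ ramificationIndex K L := by exact_mod_cast this
    have h2 : (0 : ℤ) ≤ i.natAbs := by positivity
    have h3 : -(i.natAbs : ℤ) ≤ i := by omega
    nlinarith
  exact continuousSMul_of_algebraMap K L this

theorem continuous_of_linearMap [IsLocalField L] [FiniteDimensional K L] (f : L →ₗ[K] L) :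
    Continuous f := by
  let _ := rankOne (K := K)
  let _ : NontriviallyNormedField K := Valued.toNontriviallyNormedField K ℤᵐ⁰
  have := continuousSMul K L
  exact f.continuous_of_finiteDimensional

variable {K L}

/-- Such elements are topologically nilpotent, a property preserved by the continuous ring map `σ`.
-/
theorem v_galois_lt_one [IsLocalField L] [FiniteDimensional K L] (σ : Gal(L/K)) {x : L}
    (hx : w x < 1) : w (σ x) < 1 := by
  have h := (continuous_of_linearMap K L σ.toLinearMap).continuousAt (x := 0)
  have hs : {y : L | w y ≤ WithZero.exp (-1)} ∈ nhds (σ.toLinearMap 0) := by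
    rw [map_zero]
    exact mem_nhds_zero_iff.mpr ⟨-1, subset_rfl⟩
  obtain ⟨i, hi⟩ := mem_nhds_zero_iff.mp (h hs)
  have hx' : w (x ^ i.natAbs) ≤ WithZero.exp i := by
    rw [map_pow]
    have : w x ≤ WithZero.exp (-1) := by
      rw [← v_lt_exp_add_one_iff]
      simpa using hx
    refine (pow_le_pow_left₀ zero_le this _).trans ?_
    rw [← WithZero.exp_nsmul, WithZero.exp_le_exp]
    simp only [nsmul_eq_mul]
    omega
  have h1 : w (σ (x ^ i.natAbs)) ≤ WithZero.exp (-1) := hi hx'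
  by_contra! hcon
  rw [map_pow, map_pow] at h1
  have := (one_le_pow₀ (n := i.natAbs) hcon).trans h1
  rw [← WithZero.exp_zero, WithZero.exp_le_exp] at this
  omega

/-- The valuation of a finite extension of a local field is Galois invariant. -/
theorem v_galois [IsLocalField L] [FiniteDimensional K L] (σ : Gal(L/K)) (x : L) :
    w (σ x) = w x := by
  have key : ∀ (τ : Gal(L/K)) (y : L), w y = 1 → w (τ y) ≤ 1 := by
    intro τ y hy
    by_contra! h
    have h2 : w (τ y)⁻¹ < 1 := by
      rw [map_inv₀]
      exact inv_lt_one_of_one_lt₀ h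
    have := v_galois_lt_one τ⁻¹ h2
    rw [map_inv₀, map_inv₀] at this
    have h3 : τ⁻¹ (τ y) = y := τ.symm_apply_apply y
    rw [h3, hy] at this
    simp at this
  have key2 : ∀ (τ : Gal(L/K)) (y : L), w y = 1 → w (τ y) = 1 := by
    intro τ y hy
    refine le_antisymm (key τ y hy) ?_
    have := key τ y⁻¹ (by simp [hy])
    rw [map_inv₀, map_inv₀] at this
    have h0 : 0 < w (τ y) := by
      rw [Valuation.pos_iff]
      intro h
      simp [(map_eq_zero τ).mp h] at hy
    exact (inv_le_one₀ h0).mp this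
  rcases eq_or_ne x 0 with rfl | hx
  · simp
  obtain ⟨i, hi⟩ : ∃ i : ℤ, w x = WithZero.exp i :=
    ⟨_, (WithZero.exp_log (by simpa using hx)).symm⟩
  obtain ⟨π, hπ0, hπ⟩ := exists_v_eq_exp (K := K) (-1)
  -- The `e`-th power of `x` becomes a unit after scaling by an element of `K`, which `σ` fixes.
  have hw : w (x ^ ramificationIndex K L * algebraMap K L (π ^ i)) = 1 := by
    rw [map_mul, v_algebraMap, map_pow, map_zpow₀, hi, hπ, ← WithZero.exp_zsmul,
      ← WithZero.exp_nsmul, ← WithZero.exp_nsmul, ← WithZero.exp_add]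
    simp
  have h2 := key2 σ _ hw
  rw [map_mul, AlgEquiv.commutes, map_mul, map_pow] at h2
  rw [map_mul, map_pow] at hw
  have hne : w (algebraMap K L (π ^ i)) ≠ 0 := by
    intro h
    rw [h, mul_zero] at hw
    exact zero_ne_one hw
  have := mul_right_cancel₀ hne (h2.trans hw.symm)
  rw [map_pow] at this
  exact (pow_left_inj₀ zero_le zero_le (ramificationIndex_ne_zero K L)).mp this

end Extension

/-! ### Valuation rings and the trace description of the different. -/

section Valued

variable {K : Type*} [Field K] [Valued K ℤᵐ⁰]

local notation "v" => (Valued.v : Valuation K ℤᵐ⁰)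

theorem mem_ringOfIntegers {x : K} : x ∈ ringOfIntegers K ↔ v x ≤ 1 := Iff.rfl

theorem isUnit_ringOfIntegers_iff {x : ringOfIntegers K} : IsUnit x ↔ v (x : K) = 1 :=
  (Valuation.integer.integers v).isUnit_iff_valuation_eq_one

theorem mem_maximalIdeal_ringOfIntegers {x : ringOfIntegers K} :
    x ∈ IsLocalRing.maximalIdeal (ringOfIntegers K) ↔ v (x : K) < 1 := by
  rw [IsLocalRing.mem_maximalIdeal, mem_nonunits_iff, isUnit_ringOfIntegers_iff]
  exact ⟨fun h => lt_of_le_of_ne x.2 h, fun h => h.ne⟩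

theorem maximalIdeal_ringOfIntegers_eq_span {ϖ : ringOfIntegers K}
    (hϖ : v (ϖ : K) = WithZero.exp (-1)) :
    IsLocalRing.maximalIdeal (ringOfIntegers K) = Ideal.span {ϖ} := by
  have hϖ0 : (ϖ : K) ≠ 0 := by
    intro h
    rw [h, map_zero] at hϖ
    exact WithZero.exp_ne_zero hϖ.symm
  ext x
  rw [mem_maximalIdeal_ringOfIntegers, Ideal.mem_span_singleton]
  constructor
  · intro hx
    have hx' : v (x : K) ≤ WithZero.exp (-1) := by
      rw [← v_lt_exp_add_one_iff]
      simpa using hx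
    refine ⟨⟨(ϖ : K)⁻¹ * x, ?_⟩, Subtype.ext ?_⟩
    · rw [mem_ringOfIntegers, map_mul, map_inv₀, hϖ]
      refine (mul_le_mul_right hx' _).trans_eq ?_
      exact inv_mul_cancel₀ WithZero.exp_ne_zero
    · change (x : K) = ϖ * ((ϖ : K)⁻¹ * x)
      rw [mul_inv_cancel_left₀ hϖ0]
  · rintro ⟨y, rfl⟩
    change v ((ϖ : K) * y) < 1
    rw [map_mul, hϖ]
    refine (mul_le_of_le_one_right' y.2).trans_lt ?_
    rw [← WithZero.exp_zero, WithZero.exp_lt_exp]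
    omega

theorem v_natCast_lt_one_iff (m : ℕ) : v (m : K) < 1 ↔ residueChar K ∣ m := by
  rw [residueChar, ← ringChar.spec, ← map_natCast (IsLocalRing.residue (ringOfIntegers K)),
    IsLocalRing.residue_eq_zero_iff, mem_maximalIdeal_ringOfIntegers]
  rfl

end Valued

section Extension

variable (K L : Type*) [Field K] [Field L] [Valued K ℤᵐ⁰] [Valued L ℤᵐ⁰] [IsLocalField K]
  [IsLocalField L] [Algebra K L] [FiniteDimensional K L] [IsGalois K L]
  [(Valued.v : Valuation K ℤᵐ⁰).HasExtension (Valued.v : Valuation L ℤᵐ⁰)]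

local notation "v" => (Valued.v : Valuation K ℤᵐ⁰)
local notation "w" => (Valued.v : Valuation L ℤᵐ⁰)

/-- The Galois action on the valuation ring. -/
@[reducible]
def galoisAction : MulSemiringAction Gal(L/K) (ringOfIntegers L) where
  smul σ x := ⟨σ x, by rw [mem_ringOfIntegers, v_galois]; exact x.2⟩
  one_smul _ := rfl
  mul_smul _ _ _ := rfl
  smul_zero σ := Subtype.ext (map_zero σ)
  smul_add σ x y := Subtype.ext (map_add σ x.1 y.1)
  smul_one σ := Subtype.ext (map_one σ)
  smul_mul σ x y := Subtype.ext (map_mul σ x.1 y.1)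

theorem isIntegral_ringOfIntegers : Algebra.IsIntegral (ringOfIntegers K) (ringOfIntegers L) := by
  let _ := galoisAction K L
  -- Integrality follows because the base is the ring of invariants of a finite group.
  have : Algebra.IsInvariant (ringOfIntegers K) (ringOfIntegers L) Gal(L/K) := by
    refine ⟨fun b hb => ?_⟩
    obtain ⟨a, ha⟩ := (IsGalois.mem_range_algebraMap_iff_fixed (F := K) (b : L)).mpr
      fun σ => congrArg Subtype.val (hb σ)
    refine ⟨⟨a, ?_⟩, Subtype.ext ha⟩
    rw [mem_ringOfIntegers, ← Valuation.HasExtension.val_map_le_one_iff v w, ha]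
    exact b.2
  exact Algebra.IsInvariant.isIntegral _ _ Gal(L/K)

theorem isIntegralClosure_ringOfIntegers :
    IsIntegralClosure (ringOfIntegers L) (ringOfIntegers K) L where
  algebraMap_injective := Subtype.val_injective
  isIntegral_iff {x} := by
    constructor
    · intro h
      exact IsIntegrallyClosed.isIntegral_iff.mp (h.tower_top (A := ringOfIntegers L))
    · rintro ⟨y, rfl⟩
      have := isIntegral_ringOfIntegers K L
      exact (Algebra.IsIntegral.isIntegral y).algebraMap

variable {K L}

theorem differentIdeal_le_maximalIdeal_pow_iff (n : ℕ) :
    differentIdeal (ringOfIntegers K) (ringOfIntegers L) ≤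
        IsLocalRing.maximalIdeal (ringOfIntegers L) ^ n ↔
      ∀ x : L, w x ≤ WithZero.exp (n : ℤ) → v (Algebra.trace K L x) ≤ 1 := by
  have := isIntegralClosure_ringOfIntegers K L
  obtain ⟨π, hπ0, hπ⟩ := exists_v_eq_exp (K := L) (-1)
  let ϖ : ringOfIntegers L := ⟨π, by
    rw [mem_ringOfIntegers, hπ, ← WithZero.exp_zero, WithZero.exp_le_exp]; omega⟩
  have hne : IsLocalRing.maximalIdeal (ringOfIntegers L) ^ n ≠ ⊥ :=
    pow_ne_zero _ (IsDiscreteValuationRing.not_a_field _)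
  rw [differentialIdeal_le_iff (K := K) (L := L) hne,
    maximalIdeal_ringOfIntegers_eq_span (ϖ := ϖ) hπ, Ideal.span_singleton_pow,
    FractionalIdeal.coeIdeal_span_singleton, FractionalIdeal.spanSingleton_inv]
  have hmem : ∀ x : L, x ∈ FractionalIdeal.spanSingleton (nonZeroDivisors (ringOfIntegers L))
      (algebraMap (ringOfIntegers L) L (ϖ ^ n))⁻¹ ↔ w x ≤ WithZero.exp (n : ℤ) := by
    intro x
    have hval : w (algebraMap (ringOfIntegers L) L (ϖ ^ n))⁻¹ = WithZero.exp (n : ℤ) := by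
      change w (π ^ n)⁻¹ = _
      rw [map_inv₀, map_pow, hπ, ← WithZero.exp_nsmul, ← WithZero.exp_neg]
      simp
    rw [FractionalIdeal.mem_spanSingleton]
    constructor
    · rintro ⟨z, rfl⟩
      rw [Algebra.smul_def, map_mul, hval]
      exact mul_le_of_le_one_left' z.2
    · intro hx
      refine ⟨⟨x * π ^ n, ?_⟩, ?_⟩
      · rw [mem_ringOfIntegers, map_mul, map_pow, hπ, ← WithZero.exp_nsmul]
        refine (mul_le_mul_left hx _).trans_eq ?_
        rw [← WithZero.exp_add]
        simp
      · change x * π ^ n * (π ^ n)⁻¹ = x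
        rw [mul_inv_cancel_right₀ (pow_ne_zero _ hπ0)]
  rw [Submodule.map_le_iff_le_comap]
  constructor
  · intro h x hx
    obtain ⟨y, hy⟩ := Submodule.mem_one.mp (h ((hmem x).mpr hx))
    have hy' : (y : K) = Algebra.trace K L x := hy
    rw [← hy']
    exact y.2
  · intro h x hx
    exact Submodule.mem_one.mpr ⟨⟨Algebra.trace K L x, h x ((hmem x).mp hx)⟩, rfl⟩

theorem le_differentExponent_iff (n : ℕ) :
    n ≤ differentExponent K L ↔
      ∀ x : L, w x ≤ WithZero.exp (n : ℤ) → v (Algebra.trace K L x) ≤ 1 := by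
  rw [← differentIdeal_le_maximalIdeal_pow_iff, ← Ideal.dvd_iff_le, differentExponent]
  have := isIntegralClosure_ringOfIntegers K L
  have hD : differentIdeal (ringOfIntegers K) (ringOfIntegers L) ≠ ⊥ := by
    rw [ne_eq, ← FractionalIdeal.coeIdeal_inj (K := L),
      coeIdeal_differentIdeal (ringOfIntegers K) K L]
    simp
  refine (FiniteMultiplicity.pow_dvd_iff_le_multiplicity ?_).symm
  refine FiniteMultiplicity.of_prime_left ?_ hD
  exact Ideal.prime_of_isPrime (IsDiscreteValuationRing.not_a_field _) inferInstance

theorem v_trace_le_one {x : L} (hx : w x ≤ WithZero.exp (differentExponent K L : ℤ)) :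
    v (Algebra.trace K L x) ≤ 1 :=
  (le_differentExponent_iff _).mp le_rfl x hx

theorem exists_one_lt_v_trace :
    ∃ x : L, w x ≤ WithZero.exp (differentExponent K L + 1 : ℤ) ∧
      1 < v (Algebra.trace K L x) := by
  have := (le_differentExponent_iff (K := K) (L := L) (differentExponent K L + 1)).not.mp
    (by omega)
  push Not at this
  exact_mod_cast this

end Extension

/-! ### Valuation classes mod `e`, and traces at valuation `-d-1`. -/

section Valued

variable {K : Type*} [Field K] [Valued K ℤᵐ⁰]

local notation "v" => (Valued.v : Valuation K ℤᵐ⁰)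

theorem v_eq_exp_neg_ord {x : K} (hx : x ≠ 0) : v x = WithZero.exp (-ord x) :=
  (v_eq_exp_iff hx).mpr (neg_neg _).symm

theorem ne_zero_of_v_eq_exp {x : K} {i : ℤ} (h : v x = WithZero.exp i) : x ≠ 0 := by
  rintro rfl
  rw [map_zero] at h
  exact WithZero.exp_ne_zero h.symm

theorem v_le_exp_of_lt {x : K} {i j : ℤ} (h : v x < WithZero.exp i) (hij : i ≤ j + 1) :
    v x ≤ WithZero.exp j :=
  v_lt_exp_add_one_iff.mp (h.trans_le (WithZero.exp_le_exp.mpr hij))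

end Valued

section Extension

variable (K L : Type*) [Field K] [Field L] [Valued L ℤᵐ⁰] [Algebra K L]

local notation "w" => (Valued.v : Valuation L ℤᵐ⁰)
local notation "e" => ramificationIndex K L

/-- The residue field extension is trivial. -/
def HasTrivialResidueExtension : Prop :=
  ∀ u : L, w u = 1 → ∃ c : K, w (u - algebraMap K L c) < 1

variable {L}

/-- The valuation of a non-zero element modulo the ramification index. -/
noncomputable def ordClass (x : L) : ZMod e := (ord x : ZMod e)

theorem ordClass_mul {x y : L} (hx : x ≠ 0) (hy : y ≠ 0) :
    ordClass K (x * y) = ordClass K x + ordClass K y := by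
  rw [ordClass, ord, map_mul, WithZero.log_mul (by simpa using hx) (by simpa using hy), ordClass,
    ordClass, ord, ord]
  push_cast
  ring

variable {K}

theorem ordClass_congr {x y : L} (h : w x = w y) : ordClass K x = ordClass K y := by
  rw [ordClass, ordClass, ord, ord, h]

theorem exists_v_sub_smul_lt (hres : HasTrivialResidueExtension K L) {x y : L} (hy : y ≠ 0)
    (hxy : w x = w y) : ∃ c : K, w (x - c • y) < w y := by
  have hy' : w y ≠ 0 := by simpa using hy
  obtain ⟨c, hc⟩ := hres (x / y) (by rw [map_div₀, hxy, div_self hy'])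
  refine ⟨c, ?_⟩
  have : x - c • y = (x / y - algebraMap K L c) * y := by
    rw [sub_mul, div_mul_cancel₀ x hy, Algebra.smul_def]
  rw [this, map_mul]
  exact mul_lt_of_lt_one_left (zero_lt_iff.mpr hy') hc

variable [Valued K ℤᵐ⁰] [IsLocalField K]
  [(Valued.v : Valuation K ℤᵐ⁰).HasExtension (Valued.v : Valuation L ℤᵐ⁰)]

local notation "v" => (Valued.v : Valuation K ℤᵐ⁰)

theorem v_smul (c : K) (x : L) : w (c • x) = v c ^ e * w x := by
  rw [Algebra.smul_def, map_mul, v_algebraMap]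

theorem v_smul_exp {c : K} {x : L} {i j : ℤ} (hc : v c = WithZero.exp i)
    (hx : w x = WithZero.exp j) : w (c • x) = WithZero.exp (e * i + j) := by
  rw [v_smul, hc, hx, ← WithZero.exp_nsmul, ← WithZero.exp_add, nsmul_eq_mul]

theorem ordClass_eq_iff {x : L} (hx : x ≠ 0) (i : ℤ) :
    ordClass K x = (i : ZMod e) ↔ ∃ c : K, c ≠ 0 ∧ w (c • x) = WithZero.exp (-i) := by
  rw [ordClass, ZMod.intCast_eq_intCast_iff_dvd_sub]
  have hx' := v_eq_exp_neg_ord hx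
  constructor
  · rintro ⟨k, hk⟩
    obtain ⟨c, hc0, hc⟩ := exists_v_eq_exp (K := K) (-k)
    refine ⟨c, hc0, ?_⟩
    rw [v_smul_exp hc hx', WithZero.exp_inj]
    linarith
  · rintro ⟨c, hc0, hc⟩
    rw [v_smul_exp (v_eq_exp_neg_ord hc0) hx', WithZero.exp_inj] at hc
    exact ⟨ord c, by linarith⟩

theorem ordClass_of_v_eq {x : L} {i : ℤ} (hx : w x = WithZero.exp (-i)) :
    ordClass K x = (i : ZMod e) :=
  (ordClass_eq_iff (ne_zero_of_v_eq_exp hx) i).mpr ⟨1, one_ne_zero, by rwa [one_smul]⟩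

theorem ordClass_smul {c : K} {x : L} (hc : c ≠ 0) (hx : x ≠ 0) :
    ordClass K (c • x) = ordClass K x := by
  obtain ⟨b, hb0, hb⟩ := (ordClass_eq_iff (K := K) hx (ord x)).mp rfl
  refine (ordClass_eq_iff (smul_ne_zero hc hx) (ord x)).mpr ⟨b * c⁻¹,
    mul_ne_zero hb0 (inv_ne_zero hc), ?_⟩
  rwa [smul_smul, inv_mul_cancel_right₀ hc]

section Trace

variable [IsLocalField L] [FiniteDimensional K L] [IsGalois K L]

local notation "d" => differentExponent K L

/-- An element of `P_L^(-d-1)` with non-integral trace is scaled by a non-unit of the valuation ring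
of `K`; this lands in `P_L^(-d)`. -/
theorem exists_trace_eq {c : K} (hc : v c ≤ 1) :
    ∃ z : L, w z ≤ WithZero.exp (d : ℤ) ∧ Algebra.trace K L z = c := by
  obtain ⟨b, hb, hb1⟩ := exists_one_lt_v_trace (K := K) (L := L)
  have ht : Algebra.trace K L b ≠ 0 := by
    intro h
    simp [h] at hb1
  refine ⟨(c / Algebra.trace K L b) • b, ?_, by
    rw [map_smul, smul_eq_mul, div_mul_cancel₀ _ ht]⟩
  have h1 : v (c / Algebra.trace K L b) ≤ WithZero.exp (-1) := by
    refine v_le_exp_of_lt (i := 0) ?_ (by omega)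
    rw [map_div₀, WithZero.exp_zero]
    exact (div_lt_one₀ (zero_lt_one.trans hb1)).mpr (hc.trans_lt hb1)
  have h2 : v (c / Algebra.trace K L b) ^ e ≤ WithZero.exp (-1) := by
    refine (pow_le_of_le_one zero_le (h1.trans ?_) (ramificationIndex_ne_zero K L)).trans h1
    rw [← WithZero.exp_zero, WithZero.exp_le_exp]
    omega
  rw [v_smul]
  refine (mul_le_mul' h2 hb).trans_eq ?_
  rw [← WithZero.exp_add, WithZero.exp_inj]
  ring

theorem v_trace_le_exp_one {x : L} (hx : w x ≤ WithZero.exp (d + 1 : ℤ)) :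
    v (Algebra.trace K L x) ≤ WithZero.exp 1 := by
  obtain ⟨π, hπ0, hπ⟩ := exists_v_eq_exp (K := K) (-1)
  have h := v_trace_le_one (K := K) (x := π • x) (by
    rw [v_smul, hπ, ← WithZero.exp_nsmul]
    refine (mul_le_mul_right hx _).trans ?_
    rw [← WithZero.exp_add, WithZero.exp_le_exp, nsmul_eq_mul]
    have : (1 : ℤ) ≤ e := by
      exact_mod_cast Nat.one_le_iff_ne_zero.mpr (ramificationIndex_ne_zero K L)
    linarith)
  rw [map_smul, smul_eq_mul, map_mul, hπ] at h
  have := mul_le_mul_right h (WithZero.exp 1)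
  rwa [← mul_assoc, ← WithZero.exp_add, mul_one, add_neg_cancel, WithZero.exp_zero,
    one_mul] at this

/-- Here `P_L^(-d-1) = O_K x + P_L^(-d)`, so an integral trace at `x` would make the trace integral
on all of `P_L^(-d-1)`, contradicting the maximality of `d`. -/
theorem one_lt_v_trace (hres : HasTrivialResidueExtension K L) {x : L}
    (hx : w x = WithZero.exp (d + 1 : ℤ)) : 1 < v (Algebra.trace K L x) := by
  obtain ⟨b, hb, hb1⟩ := exists_one_lt_v_trace (K := K) (L := L)
  by_contra! hcon
  have hb' : w b = w x := by
    rw [hx]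
    refine hb.antisymm (not_lt.mp fun h => ?_)
    exact (v_trace_le_one (K := K) (v_lt_exp_add_one_iff.mp h)).not_gt hb1
  have hx0 := ne_zero_of_v_eq_exp hx
  obtain ⟨c, hc⟩ := exists_v_sub_smul_lt hres hx0 hb'
  have h2 : v (Algebra.trace K L (b - c • x)) ≤ 1 := by
    refine v_trace_le_one (v_lt_exp_add_one_iff.mp ?_)
    rwa [← hx]
  -- Otherwise `c • x` would dominate `b`, and no cancellation could occur.
  have hc1 : v c ≤ 1 := by
    by_contra! h1
    have h3 : w x < w (c • x) := by
      rw [v_smul]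
      refine lt_mul_of_one_lt_left (zero_lt_iff.mpr (by simpa using hx0)) ?_
      exact one_lt_pow₀ h1 (ramificationIndex_ne_zero K L)
    rw [Valuation.map_sub_eq_of_lt_right _ (hb'.trans_lt h3)] at hc
    exact hc.not_gt h3
  rw [map_sub, map_smul, smul_eq_mul] at h2
  have h4 := v_add_le h2 (i := 1) (y := c * Algebra.trace K L x) (by
    rw [map_mul]
    exact mul_le_one' hc1 hcon)
  rw [sub_add_cancel] at h4
  exact h4.not_gt hb1

theorem trace_ne_zero (hres : HasTrivialResidueExtension K L) {x : L} (hx0 : x ≠ 0)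
    (hx : ordClass K x = ((-(d : ℤ) - 1 : ℤ) : ZMod e)) : Algebra.trace K L x ≠ 0 := by
  obtain ⟨c, hc0, hc⟩ := (ordClass_eq_iff hx0 _).mp hx
  intro h
  have := one_lt_v_trace hres (x := c • x) (by rw [hc, WithZero.exp_inj]; ring)
  simp [h] at this

theorem exists_trace_eq_zero (hres : ¬ HasTrivialResidueExtension K L) :
    ∃ y : L, w y = WithZero.exp (d + 1 : ℤ) ∧ Algebra.trace K L y = 0 := by
  rw [HasTrivialResidueExtension] at hres
  push Not at hres
  obtain ⟨u, hu, hres⟩ := hres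
  obtain ⟨a, ha0, ha⟩ := exists_v_eq_exp (K := L) (d + 1 : ℤ)
  -- An integral trace can be removed by an element of `P_L^(-d)`. Otherwise `a` and `u * a` are
  -- combined; as the residue of `u` is not in the residue field of `K`, the leading terms do not
  -- cancel.
  by_cases h : v (Algebra.trace K L a) ≤ 1
  · obtain ⟨z, hz, hzt⟩ := exists_trace_eq (L := L) h
    refine ⟨a - z, ?_, by rw [map_sub, hzt, sub_self]⟩
    rw [Valuation.map_sub_eq_of_lt_left, ha]
    rw [ha]
    exact v_lt_exp_add_one_iff.mpr hz
  · have ht0 : Algebra.trace K L a ≠ 0 := by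
      intro h0
      simp [h0] at h
    have ht : WithZero.exp 1 ≤ v (Algebra.trace K L a) := by
      by_contra! h1
      exact h (by simpa using v_lt_exp_add_one_iff (i := 0).mp (by simpa using h1))
    set c := Algebra.trace K L (u * a) / Algebra.trace K L a with hc
    have hc1 : v c ≤ 1 := by
      rw [hc, map_div₀]
      refine (div_le_one₀ (WithZero.exp_pos.trans_le ht)).mpr (le_trans ?_ ht)
      refine v_trace_le_exp_one ?_
      rw [map_mul, hu, one_mul, ha]
    refine ⟨u * a - c • a, ?_, ?_⟩
    · have : u * a - c • a = (u - algebraMap K L c) * a := by rw [sub_mul, Algebra.smul_def]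
      rw [this, map_mul, ha]
      have h1 : w (u - algebraMap K L c) = 1 := by
        refine le_antisymm (v_sub_le hu.le ?_) (hres c)
        exact (Valuation.HasExtension.val_map_le_one_iff v w c).mpr hc1
      rw [h1, one_mul]
    · rw [map_sub, map_smul, smul_eq_mul, hc, div_mul_cancel₀ _ ht0, sub_self]

end Trace

end Extension

/-! ### Total ramification, and counting valuation classes. -/

section Extension

variable {K L : Type*} [Field K] [Field L] [Valued K ℤᵐ⁰] [Valued L ℤᵐ⁰] [Algebra K L]
  [IsLocalField K] [(Valued.v : Valuation K ℤᵐ⁰).HasExtension (Valued.v : Valuation L ℤᵐ⁰)]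

local notation "v" => (Valued.v : Valuation K ℤᵐ⁰)
local notation "w" => (Valued.v : Valuation L ℤᵐ⁰)
local notation "e" => ramificationIndex K L

instance : NeZero (ramificationIndex K L) := ⟨ramificationIndex_ne_zero K L⟩

variable (K L) in
theorem exists_ordClass_section [IsLocalField L] :
    ∃ β : ZMod e → L, β 0 = 1 ∧ ∀ s, β s ≠ 0 ∧ ordClass K (β s) = s := by
  have h : ∀ s : ZMod e, ∃ x : L, x ≠ 0 ∧ ordClass K x = s := by
    intro s
    obtain ⟨x, hx0, hx⟩ := exists_v_eq_exp (K := L) (-(s.val : ℤ))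
    exact ⟨x, hx0, by simpa using ordClass_of_v_eq (K := K) hx⟩
  choose β hβ0 hβ using h
  refine ⟨Function.update β 0 1, Function.update_self .., fun s => ?_⟩
  rcases eq_or_ne s 0 with rfl | hs
  · rw [Function.update_self]
    exact ⟨one_ne_zero, by
      simpa using ordClass_of_v_eq (K := K) (L := L) (x := 1) (i := 0) (by simp)⟩
  · rw [Function.update_of_ne hs]
    exact ⟨hβ0 s, hβ s⟩

/-- Non-zero terms lie in different classes mod `e`, so no two have the same valuation. -/
theorem exists_dominant_term {β : ZMod e → L} (hβ : ∀ s, β s ≠ 0 ∧ ordClass K (β s) = s)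
    {a : ZMod e → K} (ha : a ≠ 0) :
    ∃ j, a j ≠ 0 ∧ w (∑ i, a i • β i) = w (a j • β j) ∧
      ∀ i ≠ j, w (a i • β i) < w (a j • β j) := by
  obtain ⟨j, hj⟩ := Finite.exists_max fun i => w (a i • β i)
  obtain ⟨k, hk⟩ := Function.ne_iff.mp ha
  have hpos : 0 < w (a j • β j) := by
    refine lt_of_lt_of_le (zero_lt_iff.mpr ?_) (hj k)
    simpa using ⟨hk, (hβ k).1⟩
  have haj : a j ≠ 0 := by
    intro h
    simp [h] at hpos
  have hlt : ∀ i ≠ j, w (a i • β i) < w (a j • β j) := by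
    intro i hij
    refine lt_of_le_of_ne (hj i) fun h => hij ?_
    have hai : a i ≠ 0 := by
      intro h0
      rw [h0, zero_smul, map_zero] at h
      exact hpos.ne h
    have := ordClass_congr (K := K) h
    rwa [ordClass_smul hai (hβ i).1, ordClass_smul haj (hβ j).1, (hβ i).2, (hβ j).2] at this
  refine ⟨j, haj, ?_, hlt⟩
  rw [← Finset.add_sum_erase _ _ (Finset.mem_univ j), Valuation.map_add_eq_of_lt_left]
  exact Valuation.map_sum_lt' _ hpos fun i hi => hlt i (Finset.ne_of_mem_erase hi)

theorem linearIndependent_of_ordClass {β : ZMod e → L}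
    (hβ : ∀ s, β s ≠ 0 ∧ ordClass K (β s) = s) : LinearIndependent K β := by
  rw [Fintype.linearIndependent_iff]
  intro a ha
  by_contra! h
  obtain ⟨j, hj, hw, -⟩ := exists_dominant_term hβ (Function.ne_iff.mpr h)
  rw [ha, map_zero, eq_comm] at hw
  simp [hj, (hβ j).1] at hw

open Classical in
variable (K) in
/-- The valuations, modulo the ramification index, of the non-zero elements of a subspace. -/
noncomputable def ordClasses (V : Submodule K L) : Finset (ZMod (ramificationIndex K L)) :=
  {s | ∃ x ∈ V, x ≠ 0 ∧ ordClass K x = s}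

theorem mem_ordClasses {V : Submodule K L} {s : ZMod e} :
    s ∈ ordClasses K V ↔ ∃ x ∈ V, x ≠ 0 ∧ ordClass K x = s := by
  simp [ordClasses]

variable [IsLocalField L]

theorem exists_basis_of_isTotallyRamified (h : IsTotallyRamified K L) :
    ∃ β : Module.Basis (ZMod e) K L, β 0 = 1 ∧ ∀ s, β s ≠ 0 ∧ ordClass K (β s) = s := by
  obtain ⟨β, hβ1, hβ⟩ := exists_ordClass_section K L
  refine ⟨basisOfLinearIndependentOfCardEqFinrank (linearIndependent_of_ordClass hβ)
    ((ZMod.card _).trans h), ?_⟩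
  rw [coe_basisOfLinearIndependentOfCardEqFinrank]
  exact ⟨hβ1, hβ⟩

theorem hasTrivialResidueExtension_of_isTotallyRamified (h : IsTotallyRamified K L) :
    HasTrivialResidueExtension K L := by
  obtain ⟨β, hβ1, hβ⟩ := exists_basis_of_isTotallyRamified h
  intro u hu
  have hu0 : u ≠ 0 := by
    rintro rfl
    simp at hu
  obtain ⟨j, hj, hw, hlt⟩ := exists_dominant_term hβ (a := β.repr u) (by simpa using hu0)
  rw [β.sum_repr] at hw
  have hj0 : j = 0 := by
    have := ordClass_congr (K := K) hw
    rw [ordClass_smul hj (hβ j).1, (hβ j).2] at this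
    rw [← this]
    simpa using ordClass_of_v_eq (K := K) (x := u) (i := 0) (by simp [hu])
  subst hj0
  refine ⟨β.repr u 0, ?_⟩
  have hsum := β.sum_repr u
  rw [← Finset.add_sum_erase _ _ (Finset.mem_univ 0), hβ1,
    ← Algebra.algebraMap_eq_smul_one] at hsum
  rw [← eq_sub_iff_add_eq'.mpr hsum]
  refine Valuation.map_sum_lt _ one_ne_zero fun i hi => ?_
  rw [← hu, hw]
  exact hlt i (Finset.ne_of_mem_erase hi)

/-- The coordinates indexed by the classes of `V` are injective on `V`: the dominant coordinate of a
non-zero vector is indexed by its own class. -/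
theorem finrank_le_card_ordClasses (h : IsTotallyRamified K L) (V : Submodule K L) :
    Module.finrank K V ≤ (ordClasses K V).card := by
  obtain ⟨β, -, hβ⟩ := exists_basis_of_isTotallyRamified h
  let f : V →ₗ[K] (ordClasses K V → K) :=
    LinearMap.pi fun s => (β.coord s.1) ∘ₗ V.subtype
  have hf : Function.Injective f := by
    rw [← LinearMap.ker_eq_bot, LinearMap.ker_eq_bot']
    intro x hx
    by_contra hne
    have hx0 : (x : L) ≠ 0 := by simpa using hne
    obtain ⟨j, hj, hw, -⟩ := exists_dominant_term hβ (a := β.repr x) (by simpa using hx0)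
    rw [β.sum_repr] at hw
    have hc := ordClass_congr (K := K) hw
    rw [ordClass_smul hj (hβ j).1, (hβ j).2] at hc
    exact hj (congrFun hx ⟨j, mem_ordClasses.mpr ⟨x, x.2, hx0, hc⟩⟩)
  simpa using LinearMap.finrank_le_finrank_of_injective hf

variable [FiniteDimensional K L]

/-- A dense subspace is everything, since `S` is closed as the kernel of the continuous map `g`, the
identity minus a projection onto `S`. -/
theorem submodule_eq_top_of_forall_exists_v_sub_le (S : Submodule K L)
    (h : ∀ (x : L) (n : ℕ), ∃ y ∈ S, w (x - y) ≤ WithZero.exp (-(n : ℤ))) : S = ⊤ := by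
  obtain ⟨f, hf⟩ := S.subtype.exists_leftInverse_of_injective S.ker_subtype
  let g : L →ₗ[K] L := LinearMap.id - S.subtype ∘ₗ f
  have hgS : ∀ y ∈ S, g y = 0 := by
    intro y hy
    have := LinearMap.congr_fun hf ⟨y, hy⟩
    have h2 : f y = ⟨y, hy⟩ := this
    simp [g, h2]
  have hg := (continuous_of_linearMap K L g).continuousAt (x := 0)
  refine (Submodule.eq_top_iff').mpr fun x => ?_
  suffices g x = 0 by
    have h2 : x - f x = 0 := this
    rw [sub_eq_zero.mp h2]
    exact (f x).2
  by_contra hne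
  have hmem : {y : L | w y ≤ WithZero.exp (-ord (g x) - 1)} ∈ nhds (g 0) := by
    rw [map_zero]
    exact mem_nhds_zero_iff.mpr ⟨_, subset_rfl⟩
  obtain ⟨i, hi⟩ := mem_nhds_zero_iff.mp (hg hmem)
  obtain ⟨y, hy, hxy⟩ := h x i.natAbs
  have h3 : w (g (x - y)) ≤ WithZero.exp (-ord (g x) - 1) :=
    hi (hxy.trans (WithZero.exp_le_exp.mpr (by omega)))
  rw [map_sub, hgS y hy, sub_zero, v_eq_exp_neg_ord hne, WithZero.exp_le_exp] at h3
  omega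

/-- Successive approximation: a multiple of the `β` in the class of the current error cancels its
leading term, so the `e` independent vectors `β` span a dense subspace. -/
theorem isTotallyRamified_of_hasTrivialResidueExtension (hres : HasTrivialResidueExtension K L) :
    IsTotallyRamified K L := by
  obtain ⟨β, -, hβ⟩ := exists_ordClass_section K L
  have step : ∀ x : L, x ≠ 0 → ∃ y ∈ Submodule.span K (Set.range β), w (x - y) < w x := by
    intro x hx
    obtain ⟨c, hc0, hc⟩ := (ordClass_eq_iff hx (ord (β (ordClass K x)))).mp (hβ _).2.symm
    have hx' : w x = w (c⁻¹ • β (ordClass K x)) := by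
      rw [v_smul, v_eq_exp_neg_ord (hβ _).1, ← hc, ← v_smul, smul_smul, inv_mul_cancel₀ hc0,
        one_smul]
    obtain ⟨t, ht⟩ := exists_v_sub_smul_lt hres
      (smul_ne_zero (inv_ne_zero hc0) (hβ (ordClass K x)).1) hx'
    refine ⟨_, ?_, ht.trans_eq hx'.symm⟩
    exact Submodule.smul_mem _ _ (Submodule.smul_mem _ _ (Submodule.subset_span ⟨_, rfl⟩))
  have approx : ∀ (x : L) (n : ℕ), ∃ y ∈ Submodule.span K (Set.range β),
      w (x - y) ≤ WithZero.exp (-ord x - n) := by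
    intro x n
    induction n with
    | zero =>
      refine ⟨0, Submodule.zero_mem _, ?_⟩
      rcases eq_or_ne x 0 with rfl | hx
      · simp
      · simp [v_eq_exp_neg_ord hx]
    | succ n ih =>
      obtain ⟨y, hy, hxy⟩ := ih
      rcases eq_or_ne (x - y) 0 with h | h
      · exact ⟨y, hy, by simp [h]⟩
      · obtain ⟨z, hz, hlt⟩ := step _ h
        refine ⟨y + z, Submodule.add_mem _ hy hz, ?_⟩
        rw [← sub_sub]
        exact v_le_exp_of_lt (hlt.trans_le hxy) (by push_cast; omega)
  have htop : Submodule.span K (Set.range β) = ⊤ := by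
    refine submodule_eq_top_of_forall_exists_v_sub_le _ fun x n => ?_
    obtain ⟨y, hy, h⟩ := approx x (n + (ord x).natAbs)
    refine ⟨y, hy, h.trans (WithZero.exp_le_exp.mpr ?_)⟩
    omega
  rw [IsTotallyRamified,
    Module.finrank_eq_card_basis (Module.Basis.mk (linearIndependent_of_ordClass hβ) htop.ge),
    ZMod.card]

variable [IsGalois K L]

local notation "d" => differentExponent K L

/-- A subspace without elements of valuation `0` is orthogonal, under the trace form, to an element
of valuation `-d - 1`. -/
theorem exists_trace_mul_eq_zero (h : IsTotallyRamified K L) (V : Submodule K L)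
    (hV : ∀ x ∈ V, w x ≠ 1) :
    ∃ x : L, w x = WithZero.exp (d + 1 : ℤ) ∧ ∀ y ∈ V, Algebra.trace K L (x * y) = 0 := by
  classical
  have hres := hasTrivialResidueExtension_of_isTotallyRamified h
  set W := (Algebra.traceForm K L).orthogonal V with hW
  have hWmem : ∀ x ∈ W, ∀ y ∈ V, Algebra.trace K L (x * y) = 0 := by
    intro x hx y hy
    rw [mul_comm]
    exact hx y hy
  set t : ZMod e := ((-(d : ℤ) - 1 : ℤ) : ZMod e) with ht
  by_cases htW : t ∈ ordClasses K W
  · obtain ⟨x, hxW, hx0, hx⟩ := mem_ordClasses.mp htW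
    obtain ⟨c, -, hc⟩ := (ordClass_eq_iff hx0 _).mp hx
    exact ⟨c • x, by rw [hc, WithZero.exp_inj]; ring, hWmem _ (W.smul_mem c hxW)⟩
  exfalso
  have h0V : (0 : ZMod e) ∉ ordClasses K V := by
    intro h0
    obtain ⟨x, hxV, hx0, hx⟩ := mem_ordClasses.mp h0
    obtain ⟨c, -, hc⟩ := (ordClass_eq_iff hx0 0).mp (by simpa using hx)
    exact hV _ (V.smul_mem c hxV) (by simpa using hc)
  -- If classes from `V` and `W` added up to `t`, the product would have non-zero trace. Both sets
  -- also miss `t`, so their sizes total less than `e`, while the dimensions of `V` and `W` total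
  -- `e`.
  have hdisj : Disjoint ((ordClasses K V).image (t - ·)) (ordClasses K W) := by
    rw [Finset.disjoint_left]
    rintro _ hs hsW
    obtain ⟨s, hsV, rfl⟩ := Finset.mem_image.mp hs
    obtain ⟨y, hyV, hy0, hy⟩ := mem_ordClasses.mp hsV
    obtain ⟨x, hxW, hx0, hx⟩ := mem_ordClasses.mp hsW
    refine trace_ne_zero hres (mul_ne_zero hx0 hy0) ?_ (hWmem x hxW y hyV)
    rw [ordClass_mul K hx0 hy0, hx, hy]
    simp [ht]
  have hnot : t ∉ ((ordClasses K V).image (t - ·)) ∪ ordClasses K W := by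
    rw [Finset.mem_union, not_or]
    refine ⟨fun hs => ?_, htW⟩
    obtain ⟨s, hsV, hst⟩ := Finset.mem_image.mp hs
    rw [sub_eq_self.mp hst] at hsV
    exact h0V hsV
  have hcard := Finset.card_lt_univ_of_notMem hnot
  rw [Finset.card_union_of_disjoint hdisj, Finset.card_image_of_injective _ sub_right_injective,
    ZMod.card] at hcard
  have h1 := finrank_le_card_ordClasses h V
  have h2 := finrank_le_card_ordClasses h W
  have h3 := LinearMap.BilinForm.finrank_orthogonal (traceForm_nondegenerate K L) V
  rw [← hW] at h3
  have he : e = Module.finrank K L := h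
  omega

end Extension

/-! ### Normal elements and the trace form. -/

section NormalElement

variable {K L : Type*} [Field K] [Field L] [Algebra K L]

theorem trace_galois [FiniteDimensional K L] [IsGalois K L] (σ : Gal(L/K)) (x : L) :
    Algebra.trace K L (σ x) = Algebra.trace K L x :=
  Algebra.trace_eq_of_algEquiv σ x

theorem trace_mul_galois_inv [FiniteDimensional K L] [IsGalois K L] (σ : Gal(L/K)) (x y : L) :
    Algebra.trace K L (x * σ⁻¹ y) = Algebra.trace K L (σ x * y) := by
  rw [← trace_galois σ, map_mul]
  congr 2
  exact σ.apply_symm_apply y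

theorem IsNormalElement.eq_zero_of_sum_eq_zero [FiniteDimensional K L] {x : L}
    (hx : IsNormalElement K x) {θ : Gal(L/K) → K} (h : ∑ σ, θ σ • σ x = 0) : θ = 0 := by
  obtain ⟨b, hb⟩ := hx
  funext σ
  exact Fintype.linearIndependent_iff.mp b.linearIndependent θ (by simpa [hb] using h) σ

variable [FiniteDimensional K L] [IsGalois K L]

theorem IsNormalElement.trace_ne_zero {x : L} (hx : IsNormalElement K x) :
    Algebra.trace K L x ≠ 0 := by
  intro h
  have := hx.eq_zero_of_sum_eq_zero (θ := 1) (by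
    simp [← trace_eq_sum_automorphisms, h])
  exact one_ne_zero (congrFun this 1)

theorem IsNormalElement.eq_zero_of_trace_eq_zero {x : L} (hx : IsNormalElement K x) {y : L}
    (h : ∀ σ : Gal(L/K), Algebra.trace K L (σ x * y) = 0) : y = 0 := by
  obtain ⟨b, hb⟩ := hx
  refine (traceForm_nondegenerate K L).1 y fun z => ?_
  have : (Algebra.traceForm K L) y = 0 := b.ext fun σ => by
    rw [hb, Algebra.traceForm_apply, mul_comm, h]
    rfl
  rw [this]
  rfl

theorem isNormalElement_of_forall_trace {x : L}
    (h : ∀ y, (∀ σ : Gal(L/K), Algebra.trace K L (σ x * y) = 0) → y = 0) :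
    IsNormalElement K x := by
  set S := Submodule.span K (Set.range fun σ : Gal(L/K) => σ x) with hS
  have hbot : (Algebra.traceForm K L).orthogonal S = ⊥ := by
    rw [eq_bot_iff]
    intro y hy
    exact h y fun σ => hy (σ x) (Submodule.subset_span ⟨σ, rfl⟩)
  have hfin := LinearMap.BilinForm.finrank_orthogonal (traceForm_nondegenerate K L) S
  rw [hbot, finrank_bot] at hfin
  have htop : S = ⊤ := by
    refine Submodule.eq_top_of_finrank_eq (le_antisymm (Submodule.finrank_le S) ?_)
    omega
  have hcard : Fintype.card Gal(L/K) = Module.finrank K L := by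
    rw [← Nat.card_eq_fintype_card, IsGalois.card_aut_eq_finrank]
  exact ⟨basisOfTopLeSpanOfCardEqFinrank _ htop.ge hcard, fun σ => by
    rw [coe_basisOfTopLeSpanOfCardEqFinrank]⟩

end NormalElement

section Coset

/-- Splits the trace into a sum over `H` followed by a sum over coset representatives. -/
theorem bijective_quotientOut_mul {G : Type*} [Group G] (H : Subgroup G) :
    Function.Bijective fun x : (G ⧸ H) × H => x.1.out * (x.2 : G) := by
  constructor
  · rintro ⟨r, h⟩ ⟨r', h'⟩ heq
    have heq' : r.out * (h : G) = r'.out * (h' : G) := heq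
    have hr : r = r' := by
      rw [← r.out_eq', ← r'.out_eq', QuotientGroup.eq]
      have : r.out⁻¹ * r'.out = h * (h' : G)⁻¹ := by
        rw [inv_mul_eq_iff_eq_mul, ← mul_assoc, heq', mul_inv_cancel_right]
      rw [this]
      exact H.mul_mem h.2 (H.inv_mem h'.2)
    subst hr
    rw [Subtype.ext (mul_left_cancel heq')]
  · intro g
    obtain ⟨h, hh⟩ := QuotientGroup.mk_out_eq_mul H g
    exact ⟨⟨g, h⁻¹⟩, by simp [hh]⟩

end Coset

/-! ### Consequences of the valuation criterion, and the converse. -/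

section Extension

variable {K L : Type*} [Field K] [Field L] [Valued K ℤᵐ⁰] [Valued L ℤᵐ⁰] [Algebra K L]
  [IsLocalField L] [(Valued.v : Valuation K ℤᵐ⁰).HasExtension (Valued.v : Valuation L ℤᵐ⁰)]

local notation "v" => (Valued.v : Valuation K ℤᵐ⁰)
local notation "w" => (Valued.v : Valuation L ℤᵐ⁰)
local notation "e" => ramificationIndex K L
local notation "d" => differentExponent K L

theorem VC.isNormalElement (h : VC K L) {x : L} (hx : w x = WithZero.exp (d + 1 : ℤ)) :
    IsNormalElement K x := by
  refine h x (ne_zero_of_v_eq_exp hx) ?_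
  rw [(v_eq_exp_iff (ne_zero_of_v_eq_exp hx)).mp hx, neg_add']

variable [IsLocalField K] [FiniteDimensional K L] [IsGalois K L]

theorem VC.isTotallyRamified (h : VC K L) : IsTotallyRamified K L := by
  refine isTotallyRamified_of_hasTrivialResidueExtension ?_
  by_contra hres
  obtain ⟨y, hy, hy0⟩ := exists_trace_eq_zero hres
  exact (h.isNormalElement hy).trace_ne_zero hy0

theorem VC.exists_v_eq_one_of_ne_bot (h : VC K L) {V : Submodule K L} (hV : IsGaloisStable V)
    (hV0 : V ≠ ⊥) : ∃ x ∈ V, w x = 1 := by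
  by_contra! hcon
  obtain ⟨x, hx, hxV⟩ := exists_trace_mul_eq_zero h.isTotallyRamified V hcon
  refine hV0 ((Submodule.eq_bot_iff V).mpr fun y hy => ?_)
  refine (h.isNormalElement hx).eq_zero_of_trace_eq_zero fun σ => ?_
  rw [← trace_mul_galois_inv]
  exact hxV _ (hV _ _ hy)

/-- The image of `φ` need not be Galois stable, so orthogonality is used directly: the adjoint of
`φ` replaces `σ⁻¹` by `σ`, and would kill a normal element. -/
theorem VC.exists_v_sum_eq_one (h : VC K L) {θ : Gal(L/K) → K} (hθ : θ ≠ 0) :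
    ∃ y : L, w (∑ σ, θ σ • σ⁻¹ y) = 1 := by
  by_contra! hcon
  let φ : L →ₗ[K] L := ∑ σ : Gal(L/K), θ σ • (σ⁻¹).toLinearMap
  have hφ : ∀ y, φ y = ∑ σ, θ σ • σ⁻¹ y := fun y => by simp [φ]
  obtain ⟨x, hx, hxV⟩ := exists_trace_mul_eq_zero h.isTotallyRamified (LinearMap.range φ) (by
    rintro _ ⟨y, rfl⟩
    rw [hφ]
    exact hcon y)
  refine hθ ((h.isNormalElement hx).eq_zero_of_sum_eq_zero ?_)
  refine (traceForm_nondegenerate K L).1 _ fun y => ?_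
  rw [Algebra.traceForm_apply, ← hxV _ ⟨y, rfl⟩, hφ, Finset.sum_mul, Finset.mul_sum, map_sum,
    map_sum]
  refine Finset.sum_congr rfl fun σ _ => ?_
  rw [smul_mul_assoc, mul_smul_comm, map_smul, map_smul, trace_mul_galois_inv]

theorem VC.subgroup_eq_top (h : VC K L) {H : Subgroup Gal(L/K)}
    (hH : ¬ residueChar K ∣ H.index) : H = ⊤ := by
  classical
  by_contra hne
  obtain ⟨g, hg⟩ : ∃ g, g ∉ H := by
    by_contra! hall
    exact hne ((Subgroup.eq_top_iff' H).mpr hall)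
  -- With the inverses in the operator, this `θ` acts as `N_H(1-g)`; it is non-zero at `1` because
  -- `g ∉ H`.
  let θ : Gal(L/K) → K := fun σ => (if σ ∈ H then 1 else 0) - if g * σ ∈ H then 1 else 0
  have hθ : θ ≠ 0 := by
    intro h0
    have := congrFun h0 1
    simp [θ, H.one_mem, hg] at this
  obtain ⟨y, hy⟩ := h.exists_v_sum_eq_one hθ
  set u := ∑ σ, θ σ • σ⁻¹ y with hu
  have hu' : u = ∑ σ : H, (σ : Gal(L/K)) (y - g y) := by
    have h1 : ∀ z : L, ∑ σ : Gal(L/K), (if σ ∈ H then (1 : K) else 0) • σ⁻¹ z =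
        ∑ σ : H, (σ : Gal(L/K)) z := by
      intro z
      simp only [ite_smul, one_smul, zero_smul]
      rw [← Finset.sum_filter, Finset.sum_subtype (p := (· ∈ H)) _ (by simp) fun σ => σ⁻¹ z]
      exact Equiv.sum_comp (Equiv.inv H) fun σ : H => (σ : Gal(L/K)) z
    have h2 : ∑ σ : Gal(L/K), (if g * σ ∈ H then (1 : K) else 0) • σ⁻¹ y =
        ∑ σ : H, (σ : Gal(L/K)) (g y) := by
      rw [← h1, ← Equiv.sum_comp (Equiv.mulLeft g)
        fun σ => (if σ ∈ H then (1 : K) else 0) • σ⁻¹ (g y)]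
      refine Finset.sum_congr rfl fun σ _ => ?_
      simp only [Equiv.coe_mulLeft, mul_inv_rev, AlgEquiv.mul_apply]
      congr 2
      exact (g.symm_apply_apply y).symm
    simp only [hu, θ, sub_smul, map_sub, Finset.sum_sub_distrib, h1, h2]
  have hsum : ∑ r : Gal(L/K) ⧸ H, r.out u = 0 := by
    have hbij := (bijective_quotientOut_mul H).sum_comp fun σ : Gal(L/K) => σ (y - g y)
    rw [Fintype.sum_prod_type, ← trace_eq_sum_automorphisms, map_sub, trace_galois, sub_self,
      map_zero] at hbij
    rw [← hbij]
    refine Finset.sum_congr rfl fun r _ => ?_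
    rw [hu', map_sum]
    rfl
  -- Each conjugate of `u` is congruent to the unit `c`, so the vanishing coset sum is congruent to
  -- `H.index * c`; the index is therefore zero in the residue field.
  obtain ⟨c, hc⟩ := hasTrivialResidueExtension_of_isTotallyRamified h.isTotallyRamified u hy
  have hsum2 : w (∑ r : Gal(L/K) ⧸ H, r.out (u - algebraMap K L c)) < 1 :=
    Valuation.map_sum_lt _ one_ne_zero fun r _ => by rwa [v_galois]
  have hmc : ∑ r : Gal(L/K) ⧸ H, r.out (u - algebraMap K L c) =
      - algebraMap K L (H.index * c) := by
    simp only [map_sub, AlgEquiv.commutes]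
    rw [Finset.sum_sub_distrib, hsum, Finset.sum_const, Finset.card_univ,
      ← Nat.card_eq_fintype_card, ← Subgroup.index, nsmul_eq_mul, zero_sub, map_mul, map_natCast]
  rw [hmc, Valuation.map_neg, Valuation.HasExtension.val_map_lt_one_iff v w, map_mul] at hsum2
  have hc1 : v c = 1 := by
    rw [← Valuation.HasExtension.val_map_eq_one_iff v w, ← hy]
    have := Valuation.map_sub_eq_of_lt_left w (x := u) (y := u - algebraMap K L c) (by rwa [hy])
    rwa [sub_sub_cancel] at this
  rw [hc1, mul_one, v_natCast_lt_one_iff] at hsum2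
  exact hH hsum2

theorem VC.exists_finrank_eq_pow (h : VC K L) : ∃ k, Module.finrank K L = residueChar K ^ k := by
  rw [← IsGalois.card_aut_eq_finrank]
  rcases CharP.char_is_prime_or_zero (IsLocalRing.ResidueField (ringOfIntegers K))
    (residueChar K) with hp | hp
  · have : Fact (residueChar K).Prime := ⟨hp⟩
    let P : Sylow (residueChar K) Gal(L/K) := default
    have htop := h.subgroup_eq_top P.not_dvd_index
    obtain ⟨k, hk⟩ := IsPGroup.iff_card.mp P.2
    exact ⟨k, by rw [← hk, htop, Subgroup.card_top]⟩
  -- In residue characteristic zero no index is divisible by `0`, so even the trivial subgroup is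
  -- everything.
  · have htop := h.subgroup_eq_top (H := ⊥) (by
      rw [hp, zero_dvd_iff, Subgroup.index_bot]
      exact Nat.card_pos.ne')
    exact ⟨0, by rw [pow_zero, ← Subgroup.card_top, ← htop, Subgroup.card_bot]⟩

theorem vc_of_forall_exists_v_eq_one (h : IsTotallyRamified K L)
    (hV : ∀ V : Submodule K L, IsGaloisStable V → V ≠ ⊥ → ∃ x ∈ V, w x = 1) : VC K L := by
  intro x hx0 hx
  refine isNormalElement_of_forall_trace fun y hy => ?_
  by_contra hy0
  -- The orthogonal of `K[G]x`. For `z` of valuation 0 in it, `x * z` keeps the class `-d-1` yet has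
  -- trace zero.
  let V : Submodule K L := ⨅ σ : Gal(L/K), LinearMap.ker (Algebra.traceForm K L (σ x))
  have hmem : ∀ z, z ∈ V ↔ ∀ σ : Gal(L/K), Algebra.trace K L (σ x * z) = 0 := fun z => by
    simp [V, Submodule.mem_iInf, Algebra.traceForm_apply]
  have hstable : IsGaloisStable V := by
    intro σ z hz
    rw [hmem] at hz ⊢
    intro τ
    rw [← hz (σ⁻¹ * τ), ← trace_mul_galois_inv, ← trace_mul_galois_inv, mul_inv_rev, inv_inv]
    rfl
  obtain ⟨z, hz, hz1⟩ := hV V hstable ((Submodule.ne_bot_iff V).mpr ⟨y, (hmem y).mpr hy, hy0⟩)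
  have hz0 : z ≠ 0 := by
    rintro rfl
    simp at hz1
  refine trace_ne_zero (hasTrivialResidueExtension_of_isTotallyRamified h) (mul_ne_zero hx0 hz0) ?_
    ((hmem z).mp hz 1)
  rw [ordClass_mul K hx0 hz0, ordClass_of_v_eq (K := K) (x := z) (i := 0) (by simpa using hz1)]
  simpa [ordClass] using (ZMod.intCast_eq_intCast_iff _ _ _).mpr hx

end Extension

end ValuationCriterion

theorem proposition2 (K L : Type*) [Field K] [Field L]
    [Valued K ℤᵐ⁰] [Valued L ℤᵐ⁰]
    [ValuationCriterion.IsLocalField K] [ValuationCriterion.IsLocalField L]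
    [Algebra K L] [FiniteDimensional K L] [IsGalois K L]
    [(Valued.v : Valuation K ℤᵐ⁰).HasExtension (Valued.v : Valuation L ℤᵐ⁰)] :
    ValuationCriterion.VC K L ↔
      (ValuationCriterion.IsTotallyRamified K L ∧
        ∃ k : ℕ, Module.finrank K L = ValuationCriterion.residueChar K ^ k) ∧
      (∀ V : Submodule K L, ValuationCriterion.IsGaloisStable V → V ≠ ⊥ →
        ∃ x ∈ V, x ≠ 0 ∧ ValuationCriterion.ord x = 0) := by
  have hord : ∀ x : L, (x ≠ 0 ∧ ValuationCriterion.ord x = 0) ↔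
      (Valued.v : Valuation L ℤᵐ⁰) x = 1 := by
    intro x
    constructor
    · rintro ⟨hx0, hx⟩
      simpa using (ValuationCriterion.v_eq_exp_iff hx0 (i := 0)).mpr (by simpa using hx)
    · intro hx
      have hx' : (Valued.v : Valuation L ℤᵐ⁰) x = WithZero.exp 0 := by simpa using hx
      have hx0 := ValuationCriterion.ne_zero_of_v_eq_exp hx'
      exact ⟨hx0, by simpa using (ValuationCriterion.v_eq_exp_iff hx0).mp hx'⟩
  simp only [hord]
  constructor
  · intro h
    exact ⟨⟨h.isTotallyRamified, h.exists_finrank_eq_pow⟩,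
      fun V hV hV0 => h.exists_v_eq_one_of_ne_bot hV hV0⟩
  · rintro ⟨⟨h, -⟩, hV⟩
    exact ValuationCriterion.vc_of_forall_exists_v_eq_one h hV
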